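/- Let $\mathbb U$ be the Urysohn space, i.e. the complete separable metric space, unique up to isometry, such that for every finite metric space $X$ and every subspace $Y\subseteq X$ (possibly empty), each isometric embedding $Y\hookrightarrow\mathbb U$ extends to an isometric embedding $X\hookrightarrow\mathbb U$. Let $\mathrm{Iso}(\mathbb U)$ be the group of all isometries of $\mathbb U$ onto itself with the topology of pointwise convergence on $\mathbb U$, and let $\mathrm{Homeo}(\mathbb I^\omega)$ be the group of all self-homeomorphisms of the Hilbert cube $\mathbb I^\omega=[0,1]^{\mathbb N}$ with the compact-open topology. Then the topological groups $\mathrm{Iso}(\mathbb U)$ and $\mathrm{Homeo}(\mathbb I^\omega)$ are not isomorphic: no group isomorphism between them is a homeomorphism. -/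

import Mathlib

/-- A metric space `M` is a (generalized) Urysohn space if, for every finite metric space `X` and
every subspace `Y` of `X` (the empty one included), each isometric embedding of `Y` into `M`
extends to an isometric embedding of `X` into `M`. -/
def IsUrysohnSpace (M : Type*) [MetricSpace M] : Prop :=
  ∀ (X : Type) [MetricSpace X] [Finite X] (Y : Set X) (f : Y → M), Isometry f →
    ∃ g : X → M, Isometry g ∧ ∀ y : Y, g y = f y

/-- The group `Iso(M)` of isometries of `M` onto itself (the product is composition). -/
abbrev IsometryGroup (M : Type*) [MetricSpace M] : Type _ := M ≃ᵢ M

/-- `Iso(M)` carries the topology of pointwise convergence on `M`. -/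
instance IsometryGroup.topologicalSpace (M : Type*) [MetricSpace M] :
    TopologicalSpace (IsometryGroup M) :=
  TopologicalSpace.induced (fun (g : M ≃ᵢ M) (x : M) => g x) inferInstance

/-- The group `Homeo(X)` of homeomorphisms of `X` onto itself (the product is composition). -/
abbrev HomeoGroup (X : Type*) [TopologicalSpace X] : Type _ := X ≃ₜ X

/-- `Homeo(X)`, for compact `X`, carries the compact-open topology, that is, the subspace topology
from `C(X, X)`. -/
instance HomeoGroup.topologicalSpace (X : Type*) [TopologicalSpace X] [CompactSpace X] :
    TopologicalSpace (HomeoGroup X) :=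
  TopologicalSpace.induced (fun h : X ≃ₜ X => (⟨h, h.continuous⟩ : C(X, X))) inferInstance

/-- The Hilbert cube: the product of countably many copies of the closed unit interval. -/
abbrev HilbertCube : Type := ℕ → unitInterval

/-! Coarse boundedness separates the two groups. `Iso(U)` is transitive on an unbounded space, so `g
↦ dist (g p) p` is continuous, subadditive and unbounded. On `Homeo` of the cube such a function is
bounded. A neighbourhood `V` of `1` only controls some first `n` coordinates. Up to a factor in `V`,
any `f` can be replaced by an `f'` that ignores a far block of `n` coordinates. Conjugating by the
swap `σ` of that block with the first one puts `f'` into `V`. Finally `σ = ρ * τ * ρ` with `ρ ∈ V`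
and `τ` independent of `f`. -/

/-- The entourages of the Hilbert cube are detected on finitely many coordinates. -/
lemma HilbertCube.exists_coordinate_entourage {E : Set (HilbertCube × HilbertCube)}
    (hE : E ∈ uniformity HilbertCube) :
    ∃ (n : ℕ) (ε : ℝ), 0 < ε ∧
      ∀ x y : HilbertCube, (∀ i < n, dist (x i) (y i) < ε) → (x, y) ∈ E := by
  -- One index bounds both the coordinates and the precision, which makes the family directed.
  let s : ℕ → Set (HilbertCube × HilbertCube) :=
    fun n => {z | ∀ i < n, dist (z.1 i) (z.2 i) < 1 / ((n : ℝ) + 1)}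
  have hs : Antitone s := fun a b hab z hz i hi =>
    (hz i (hi.trans_le hab)).trans_le (Nat.one_div_le_one_div hab)
  have hle : ⨅ n, Filter.principal (s n) ≤ uniformity HilbertCube := by
    rw [Pi.uniformity]
    refine le_iInf fun i => ?_
    rw [← Filter.tendsto_iff_comap, Metric.uniformity_basis_dist.tendsto_right_iff]
    intro ε hε
    obtain ⟨k, hk⟩ := exists_nat_one_div_lt hε
    refine Filter.mem_iInf_of_mem (max k (i + 1)) (Filter.mem_principal.mpr fun z hz => ?_)
    have h1 := hz i (by omega)
    exact h1.trans ((Nat.one_div_le_one_div (le_max_left k (i + 1))).trans_lt hk)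
  obtain ⟨n, hn⟩ := (Filter.mem_iInf_of_directed
    (Filter.monotone_principal.comp_antitone hs).directed_ge E).mp (hle hE)
  exact ⟨n, 1 / ((n : ℝ) + 1), Nat.one_div_pos_of_nat, fun x y h =>
    (Filter.mem_principal.mp hn : s n ⊆ E) (show (x, y) ∈ s n from h)⟩

/-- A neighbourhood of the identity in the homeomorphism group of the Hilbert cube contains all
homeomorphisms that move finitely many given coordinates by little. -/
lemma HomeoGroup.exists_coordinate_nhds {V : Set (HomeoGroup HilbertCube)}
    (hV : V ∈ nhds (1 : HomeoGroup HilbertCube)) :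
    ∃ (n : ℕ) (ε : ℝ), 0 < ε ∧ ∀ h : HomeoGroup HilbertCube,
      (∀ x, ∀ i < n, dist (h x i) (x i) < ε) → h ∈ V := by
  rw [nhds_induced, Filter.mem_comap] at hV
  obtain ⟨W, hW, hWV⟩ := hV
  obtain ⟨E, hE, hEW⟩ := (nhds_basis_uniformity
    ContinuousMap.hasBasis_compactConvergenceUniformity_of_compact).mem_iff.mp hW
  obtain ⟨n, ε, hε, hn⟩ := HilbertCube.exists_coordinate_entourage hE
  exact ⟨n, ε, hε, fun h hh => hWV (hEW fun x => hn _ _ (hh x))⟩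

/-- A continuous self-map of the Hilbert cube depends, up to a small error in finitely many
coordinates, on finitely many coordinates only. -/
lemma HilbertCube.exists_coordinate_modulus {f : HilbertCube → HilbertCube} (hf : Continuous f)
    (n : ℕ) {ε : ℝ} (hε : 0 < ε) :
    ∃ m : ℕ, ∀ x y : HilbertCube, (∀ i < m, x i = y i) → ∀ i < n, dist (f x i) (f y i) < ε := by
  have hE : {z : HilbertCube × HilbertCube | ∀ i ∈ Finset.range n, dist (f z.1 i) (f z.2 i) < ε} ∈
      uniformity HilbertCube := by
    refine (Filter.eventually_all_finset _).mpr fun i _ => ?_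
    exact ((Pi.uniformContinuous_proj _ i).comp
      (CompactSpace.uniformContinuous_of_continuous hf)) (Metric.dist_mem_uniformity hε)
  obtain ⟨m, δ, hδ, hm⟩ := HilbertCube.exists_coordinate_entourage hE
  exact ⟨m, fun x y h i hi => hm x y (fun k hk => by rw [h k hk, dist_self]; exact hδ) i
    (Finset.mem_range.mpr hi)⟩

/-! ### Homeomorphisms acting on chosen coordinates -/

namespace HilbertCube

/-- The action of a continuous map on the coordinates in the range of `j`. -/
noncomputable def extendFun (j : ℕ → ℕ) (f : HilbertCube → HilbertCube) (x : HilbertCube) : HilbertCube :=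
  Function.extend j (f (x ∘ j)) x

lemma extendFun_apply {j : ℕ → ℕ} (hj : Function.Injective j) (f : HilbertCube → HilbertCube)
    (x : HilbertCube) (i : ℕ) : extendFun j f x (j i) = f (x ∘ j) i :=
  hj.extend_apply _ _ _

lemma extendFun_apply_of_notMem {j : ℕ → ℕ} {k : ℕ} (hk : ¬∃ i, j i = k)
    (f : HilbertCube → HilbertCube) (x : HilbertCube) : extendFun j f x k = x k :=
  Function.extend_apply' _ _ _ hk

lemma continuous_extendFun {j : ℕ → ℕ} (hj : Function.Injective j)
    {f : HilbertCube → HilbertCube} (hf : Continuous f) : Continuous (extendFun j f) := by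
  refine continuous_pi fun k => ?_
  by_cases hk : ∃ i, j i = k
  · obtain ⟨i, rfl⟩ := hk
    simp only [extendFun_apply hj]
    exact (continuous_apply i).comp
      (hf.comp (continuous_pi fun l => continuous_apply (j l)))
  · simp only [extendFun_apply_of_notMem hk]
    exact continuous_apply k

lemma extendFun_extendFun {j : ℕ → ℕ} (hj : Function.Injective j)
    {f g : HilbertCube → HilbertCube} (hfg : Function.LeftInverse f g) (x : HilbertCube) :
    extendFun j f (extendFun j g x) = x := by
  have hc : extendFun j g x ∘ j = g (x ∘ j) := funext fun i => extendFun_apply hj g x i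
  funext k
  by_cases hk : ∃ i, j i = k
  · obtain ⟨i, rfl⟩ := hk
    rw [extendFun_apply hj, hc, hfg, Function.comp_apply]
  · rw [extendFun_apply_of_notMem hk, extendFun_apply_of_notMem hk]

/-- The homeomorphism acting as `f` on the coordinates in the range of `j`, and trivially on the
others. -/
noncomputable def extendHomeo {j : ℕ → ℕ} (hj : Function.Injective j) (f : HomeoGroup HilbertCube) :
    HomeoGroup HilbertCube where
  toFun := extendFun j f
  invFun := extendFun j f.symm
  left_inv := extendFun_extendFun hj f.symm_apply_apply
  right_inv := extendFun_extendFun hj f.apply_symm_apply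
  continuous_toFun := continuous_extendFun hj f.continuous
  continuous_invFun := continuous_extendFun hj f.symm.continuous

/-- The involution of the Hilbert cube induced by an involution of the set of coordinates. -/
def involution (σ : ℕ → ℕ) (hσ : Function.Involutive σ) : HomeoGroup HilbertCube where
  toFun x := x ∘ σ
  invFun x := x ∘ σ
  left_inv x := by funext i; simp [hσ i]
  right_inv x := by funext i; simp [hσ i]
  continuous_toFun := continuous_pi fun i => continuous_apply (σ i)
  continuous_invFun := continuous_pi fun i => continuous_apply (σ i)

lemma involution_mul_self (σ : ℕ → ℕ) (hσ : Function.Involutive σ) :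
    involution σ hσ * involution σ hσ = 1 := by
  ext1 x
  exact (involution σ hσ).symm_apply_apply x

/-- The exchange of the blocks of length `n` that start at `a` and at `b`. -/
def blockSwap (n a b i : ℕ) : ℕ :=
  if a ≤ i ∧ i < a + n then i - a + b else if b ≤ i ∧ i < b + n then i - b + a else i

lemma blockSwap_involutive {n a b : ℕ} (h : a + n ≤ b) : Function.Involutive (blockSwap n a b) := by
  intro i
  unfold blockSwap
  split_ifs <;> omega

end HilbertCube

open HilbertCube in
/-- The homeomorphism group of the Hilbert cube is coarsely bounded: a subadditive function that is
bounded near the identity is bounded above. -/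
theorem HomeoGroup.bounded_of_subadditive (l : HomeoGroup HilbertCube → ℝ)
    (hl : ∀ f g, l (f * g) ≤ l f + l g) {V : Set (HomeoGroup HilbertCube)}
    (hV : V ∈ nhds (1 : HomeoGroup HilbertCube)) {c : ℝ} (hc : ∀ f ∈ V, l f ≤ c) :
    ∃ C, ∀ f, l f ≤ C := by
  obtain ⟨n, ε, hε, hn⟩ := exists_coordinate_nhds hV
  have hτ : Function.Involutive (blockSwap n 0 n) := blockSwap_involutive (by omega)
  set τ := involution _ hτ
  -- `f` will be a product of six elements of `V` and two copies of `τ`.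
  refine ⟨6 * c + 2 * l τ, fun f => ?_⟩
  obtain ⟨m₀, hm₀⟩ := exists_coordinate_modulus f.continuous n hε
  -- The spare block `[m, m + n)` lies beyond the coordinates that matter for `f`, and is disjoint
  -- from `[0, 2n)`.
  set m := m₀ + 2 * n with hm
  have hρ : Function.Involutive (blockSwap n n m) := blockSwap_involutive (by omega)
  set ρ := involution _ hρ
  -- `j` skips exactly the spare block, so `f'` fixes those coordinates.
  let j : ℕ → ℕ := fun i => if i < m then i else i + n
  have hj : Function.Injective j := by
    intro a b
    simp only [j]
    split_ifs <;> omega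
  set f' := extendHomeo hj f
  set σ := ρ * τ * ρ with hσ
  have hσσ : σ * σ = 1 := by
    have h1 : ρ * ρ = 1 := involution_mul_self _ hρ
    have h2 : τ * τ = 1 := involution_mul_self _ hτ
    calc σ * σ = ρ * (τ * (ρ * ρ) * τ) * ρ := by simp only [hσ, mul_assoc]
      _ = 1 := by rw [h1, mul_one, h2, mul_one, h1]
  have hρV : ρ ∈ V := by
    refine hn _ fun x i hi => ?_
    have : ρ x i = x (blockSwap n n m i) := rfl
    have h2 : blockSwap n n m i = i := by
      unfold blockSwap
      split_ifs <;> omega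
    rw [this, h2, dist_self]
    exact hε
  -- At the point `f' x` this compares `f x` with `f (x ∘ j)`, whose arguments agree below `m`.
  have hclose : f * f'⁻¹ ∈ V := by
    refine hn _ fun y i hi => ?_
    obtain ⟨x, rfl⟩ := f'.surjective y
    have h1 : (f * f'⁻¹) (f' x) = f x := congrArg f (f'.symm_apply_apply x)
    have hji : j i = i := if_pos (by omega)
    have h2 : f' x i = f (x ∘ j) i := by
      conv_lhs => rw [← hji]
      exact extendFun_apply hj f x i
    rw [h1, h2]
    refine hm₀ _ _ (fun k hk => ?_) i hi
    have hjk : j k = k := if_pos (by omega)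
    rw [Function.comp_apply, hjk]
  -- `σ` exchanges `[0, n)` with the spare block, so the conjugate fixes the first `n` coordinates.
  have hconj : σ * f' * σ ∈ V := by
    refine hn _ fun x i hi => ?_
    let s : ℕ → ℕ := blockSwap n n m ∘ blockSwap n 0 n ∘ blockSwap n n m
    have hσx : ∀ x : HilbertCube, σ x = x ∘ s := fun x => rfl
    have h1 : s i = i + m := by
      simp only [s, Function.comp_apply, blockSwap]
      split_ifs <;> omega
    have h2 : s (i + m) = i := by
      simp only [s, Function.comp_apply, blockSwap]
      split_ifs <;> omega
    have h3 : ¬∃ k, j k = i + m := by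
      rintro ⟨k, hk⟩
      simp only [j] at hk
      split_ifs at hk <;> omega
    have h4 : (σ * f' * σ) x i = x i := by
      change σ (f' (σ x)) i = x i
      rw [hσx, Function.comp_apply, h1]
      change extendFun j f (σ x) (i + m) = x i
      rw [extendFun_apply_of_notMem h3, hσx, Function.comp_apply, h2]
    rw [h4, dist_self]
    exact hε
  have hf : f = f * f'⁻¹ * (σ * (σ * f' * σ) * σ) := by
    have : σ * (σ * f' * σ) * σ = (σ * σ) * f' * (σ * σ) := by simp only [mul_assoc]
    rw [this, hσσ, one_mul, mul_one, inv_mul_cancel_right]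
  have hlσ : l σ ≤ 2 * c + l τ := by
    linarith [hl (ρ * τ) ρ, hl ρ τ, hc ρ hρV]
  have := hl (f * f'⁻¹) (σ * (σ * f' * σ) * σ)
  rw [← hf] at this
  linarith [hl (σ * (σ * f' * σ)) σ, hl σ (σ * f' * σ), hc _ hclose, hc _ hconj]

/-! ### Back-and-forth in the Urysohn space -/

namespace IsUrysohnSpace

variable {M : Type*} [MetricSpace M]

/-- A partial isometry, given as a binary relation. -/
def IsPartialIsometry (S : Set (M × M)) : Prop :=
  ∀ p ∈ S, ∀ q ∈ S, dist p.1 q.1 = dist p.2 q.2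

lemma IsPartialIsometry.swap {S : Set (M × M)} (hS : IsPartialIsometry S) :
    IsPartialIsometry (Prod.swap '' S) := by
  rintro _ ⟨p, hp, rfl⟩ _ ⟨q, hq, rfl⟩
  exact (hS p hp q hq).symm

lemma IsPartialIsometry.closure {S : Set (M × M)} (hS : IsPartialIsometry S) :
    IsPartialIsometry (closure S) := by
  intro p hp q hq
  have hcl : IsClosed {z : (M × M) × (M × M) | dist z.1.1 z.2.1 = dist z.1.2 z.2.2} :=
    isClosed_eq (by fun_prop) (by fun_prop)
  have hsub : S ×ˢ S ⊆ {z : (M × M) × (M × M) | dist z.1.1 z.2.1 = dist z.1.2 z.2.2} :=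
    fun z hz => hS _ hz.1 _ hz.2
  have hz : (p, q) ∈ _root_.closure (S ×ˢ S) := by
    rw [closure_prod_eq]
    exact ⟨hp, hq⟩
  exact closure_minimal hsub hcl hz

/-- In a Urysohn space a finite partial isometry extends to any further point. -/
lemma exists_insert (hM : IsUrysohnSpace M) {S : Set (M × M)} (hfin : S.Finite)
    (hS : IsPartialIsometry S) (x : M) : ∃ y, IsPartialIsometry (insert (x, y) S) := by
  classical
  have hT : (insert x (Prod.fst '' S)).Finite := (hfin.image _).insert x
  have := hT.to_subtype
  obtain ⟨k, ⟨e⟩⟩ := Finite.exists_equiv_fin (insert x (Prod.fst '' S) : Set M)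
  let u : Fin k → M := fun i => (e.symm i : M)
  have hu : Function.Injective u := Subtype.val_injective.comp e.symm.injective
  -- The finite domain is copied to `Fin k`, since the extension property quantifies over `Type`
  -- while `M` may live in any universe.
  let _ : MetricSpace (Fin k) := MetricSpace.induced u hu inferInstance
  have hdist : ∀ i i' : Fin k, dist i i' = dist (u i) (u i') := fun _ _ => rfl
  let Y : Set (Fin k) := {i | u i ∈ Prod.fst '' S}
  have hY : ∀ i : Y, ∃ p ∈ S, p.1 = u i := fun i => i.2
  choose f hfS hf using hY
  have hiso : Isometry fun i : Y => (f i).2 := by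
    refine Isometry.of_dist_eq fun a b => ?_
    rw [← hS _ (hfS a) _ (hfS b), hf, hf]
    rfl
  obtain ⟨g, hg, hgf⟩ := hM (Fin k) Y _ hiso
  have hux : u (e ⟨x, Set.mem_insert _ _⟩) = x := by simp [u]
  have key : ∀ p ∈ S, dist x p.1 = dist (g (e ⟨x, Set.mem_insert _ _⟩)) p.2 := by
    intro p hp
    have hup : u (e ⟨p.1, Set.mem_insert_of_mem _ ⟨p, hp, rfl⟩⟩) = p.1 := by simp [u]
    have hmem : e ⟨p.1, Set.mem_insert_of_mem _ ⟨p, hp, rfl⟩⟩ ∈ Y := by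
      change u _ ∈ Prod.fst '' S
      rw [hup]
      exact ⟨p, hp, rfl⟩
    have h1 := hgf ⟨_, hmem⟩
    -- A partial isometry is single-valued, so the choice of `f` does not matter.
    have h2 : (f ⟨_, hmem⟩).2 = p.2 := by
      rw [← dist_eq_zero, ← hS _ (hfS _) _ hp, hf, hup, dist_self]
    rw [← h2, ← h1, hg.dist_eq, hdist, hux, hup]
  refine ⟨g (e ⟨x, Set.mem_insert _ _⟩), ?_⟩
  rintro p (rfl | hp) q (rfl | hq)
  · simp
  · exact key q hq
  · rw [dist_comm, key p hp, dist_comm]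
  · exact hS p hp q hq

/-- One back-and-forth step: a point is added to the domain, then to the range by applying
`exists_insert` to the inverse relation. -/
lemma exists_extension (hM : IsUrysohnSpace M) {S : Set (M × M)} (hfin : S.Finite)
    (hS : IsPartialIsometry S) (x : M) :
    ∃ T : Set (M × M), T.Finite ∧ IsPartialIsometry T ∧ S ⊆ T ∧
      x ∈ Prod.fst '' T ∧ x ∈ Prod.snd '' T := by
  obtain ⟨y, hy⟩ := hM.exists_insert hfin hS x
  obtain ⟨z, hz⟩ := hM.exists_insert ((hfin.insert (x, y)).image Prod.swap) hy.swap x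
  refine ⟨Prod.swap '' insert (x, z) (Prod.swap '' insert (x, y) S),
    (((hfin.insert _).image _).insert _).image _, hz.swap, fun p hp => ?_, ?_, ?_⟩
  · exact ⟨p.swap, Or.inr ⟨p, Or.inr hp, rfl⟩, p.swap_swap⟩
  · exact ⟨(x, y), ⟨(y, x), Or.inr ⟨(x, y), Or.inl rfl, rfl⟩, rfl⟩, rfl⟩
  · exact ⟨(z, x), ⟨(x, z), Or.inl rfl, rfl⟩, rfl⟩

/-- A partial isometry with dense domain and dense range extends to a surjective isometry. -/
lemma IsPartialIsometry.exists_isometryEquiv [CompleteSpace M] {S : Set (M × M)}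
    (hS : IsPartialIsometry S) (h₁ : Dense (Prod.fst '' S)) (h₂ : Dense (Prod.snd '' S)) :
    ∃ g : M ≃ᵢ M, ∀ p ∈ S, g p.1 = p.2 := by
  -- Both projections of the closed graph are isometries for the max metric. Their ranges are
  -- complete, hence closed, and dense, so both are onto.
  have hR := hS.closure
  have hd : ∀ a b : _root_.closure S, dist a b = dist a.1.1 b.1.1 := fun a b => by
    rw [Subtype.dist_eq, Prod.dist_eq, ← hR _ a.2 _ b.2, max_self]
  have i₁ : Isometry fun a : _root_.closure S => a.1.1 :=
    Isometry.of_dist_eq fun a b => (hd a b).symm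
  have i₂ : Isometry fun a : _root_.closure S => a.1.2 :=
    Isometry.of_dist_eq fun a b => by rw [hd a b, hR _ a.2 _ b.2]
  have : CompleteSpace (_root_.closure S) := isClosed_closure.completeSpace_coe
  have s₁ : Function.Surjective fun a : _root_.closure S => a.1.1 := by
    rw [← Set.range_eq_univ, ← i₁.isClosedEmbedding.isClosed_range.closure_eq]
    refine (h₁.mono ?_).closure_eq
    rintro _ ⟨p, hp, rfl⟩
    exact ⟨⟨p, subset_closure hp⟩, rfl⟩
  have s₂ : Function.Surjective fun a : _root_.closure S => a.1.2 := by
    rw [← Set.range_eq_univ, ← i₂.isClosedEmbedding.isClosed_range.closure_eq]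
    refine (h₂.mono ?_).closure_eq
    rintro _ ⟨p, hp, rfl⟩
    exact ⟨⟨p, subset_closure hp⟩, rfl⟩
  let e₁ : _root_.closure S ≃ᵢ M := ⟨Equiv.ofBijective _ ⟨i₁.injective, s₁⟩, i₁⟩
  let e₂ : _root_.closure S ≃ᵢ M := ⟨Equiv.ofBijective _ ⟨i₂.injective, s₂⟩, i₂⟩
  refine ⟨e₁.symm.trans e₂, fun p hp => ?_⟩
  have : e₁.symm p.1 = ⟨p, subset_closure hp⟩ := e₁.symm_apply_eq.mpr rfl
  rw [IsometryEquiv.trans_apply, this]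
  rfl

/-- The isometry group of the complete separable Urysohn space is transitive. -/
theorem exists_isometryEquiv_apply_eq [CompleteSpace M] [TopologicalSpace.SeparableSpace M]
    (hM : IsUrysohnSpace M) (x y : M) : ∃ g : M ≃ᵢ M, g x = y := by
  have : Nonempty M := ⟨x⟩
  let P := {S : Set (M × M) // S.Finite ∧ IsPartialIsometry S}
  have hstep : ∀ (S : P) (z : M), ∃ T : P, S.1 ⊆ T.1 ∧
      z ∈ Prod.fst '' T.1 ∧ z ∈ Prod.snd '' T.1 := fun S z => by
    obtain ⟨T, h₁, h₂, h₃⟩ := hM.exists_extension S.2.1 S.2.2 z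
    exact ⟨⟨T, h₁, h₂⟩, h₃⟩
  choose F hF hF₁ hF₂ using hstep
  let d := TopologicalSpace.denseSeq M
  let S₀ : P := ⟨{(x, y)}, Set.finite_singleton _, by
    rintro _ rfl _ rfl
    simp⟩
  -- Stage `n + 1` puts the `n`th point of a dense sequence into both domain and range.
  let A : ℕ → P := fun n => Nat.rec S₀ (fun n S => F S (d n)) n
  have hmono : Monotone fun n => (A n).1 := monotone_nat_of_le_succ fun n => hF (A n) (d n)
  have hiso : IsPartialIsometry (⋃ n, (A n).1) := by
    intro p hp q hq
    obtain ⟨a, ha⟩ := Set.mem_iUnion.mp hp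
    obtain ⟨b, hb⟩ := Set.mem_iUnion.mp hq
    exact (A (max a b)).2.2 p (hmono (le_max_left a b) ha) q (hmono (le_max_right a b) hb)
  have hdense := TopologicalSpace.denseRange_denseSeq M
  obtain ⟨g, hg⟩ := hiso.exists_isometryEquiv
    (hdense.mono (Set.range_subset_iff.mpr fun n =>
      Set.image_mono (Set.subset_iUnion _ (n + 1)) (hF₁ (A n) (d n))))
    (hdense.mono (Set.range_subset_iff.mpr fun n =>
      Set.image_mono (Set.subset_iUnion _ (n + 1)) (hF₂ (A n) (d n))))
  exact ⟨g, hg (x, y) (Set.mem_iUnion.mpr ⟨0, rfl⟩)⟩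

lemma nonempty (hM : IsUrysohnSpace M) : Nonempty M := by
  obtain ⟨g, -⟩ := hM PUnit ∅ (fun y => y.2.elim) (fun y => y.2.elim)
  exact ⟨g PUnit.unit⟩

/-- Extend the map `0 ↦ x` to the subspace `{0, r}` of `ℝ`. This is what makes the space unbounded.
-/
lemma exists_dist_eq (hM : IsUrysohnSpace M) (x : M) {r : ℝ} (hr : 0 ≤ r) :
    ∃ y, dist y x = r := by
  let X : Set ℝ := {0, r}
  let o : X := ⟨0, Or.inl rfl⟩
  obtain ⟨g, hg, hgx⟩ := hM X {o} (fun _ => x) isometry_subsingleton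
  refine ⟨g ⟨r, Or.inr rfl⟩, ?_⟩
  rw [← hgx ⟨o, rfl⟩, hg.dist_eq, Subtype.dist_eq, Real.dist_eq, sub_zero, abs_of_nonneg hr]

end IsUrysohnSpace

/-- For `U` the Urysohn space (the complete separable Urysohn metric space, unique up to isometry),
the topological groups `Iso(U)` and `Homeo` of the Hilbert cube are not isomorphic: there is no
group isomorphism between them that is a homeomorphism. -/
theorem mainTheorem4 (U : Type*) [MetricSpace U] [CompleteSpace U]
    [TopologicalSpace.SeparableSpace U] (hU : IsUrysohnSpace U) :
    IsEmpty (IsometryGroup U ≃ₜ* HomeoGroup HilbertCube) := by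
  refine ⟨fun φ => ?_⟩
  obtain ⟨p⟩ := hU.nonempty
  let l : HomeoGroup HilbertCube → ℝ := fun f => dist (φ.symm f p) p
  have hl : ∀ f g, l (f * g) ≤ l f + l g := fun f g => by
    have h1 : φ.symm (f * g) p = φ.symm f (φ.symm g p) := by
      rw [map_mul]
      rfl
    have h2 := dist_triangle (φ.symm f (φ.symm g p)) (φ.symm f p) p
    rw [(φ.symm f).dist_eq] at h2
    simp only [l, h1]
    linarith
  have hev : Continuous fun g : IsometryGroup U => g p :=
    (continuous_apply p).comp continuous_induced_dom
  have hcont : Continuous l := (hev.comp φ.symm.continuous).dist continuous_const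
  have h1 : l 1 = 0 := by
    have : φ.symm 1 p = p := by
      rw [map_one]
      rfl
    simp only [l, this, dist_self]
  have hV : {f | l f < 1} ∈ nhds (1 : HomeoGroup HilbertCube) :=
    (isOpen_lt hcont continuous_const).mem_nhds (by simp [h1])
  obtain ⟨C, hC⟩ := HomeoGroup.bounded_of_subadditive l hl hV fun f hf => le_of_lt hf
  -- The absolute value keeps the distance nonnegative, whatever the sign of `C`.
  obtain ⟨q, hq⟩ := hU.exists_dist_eq p (r := |C| + 1) (by positivity)
  obtain ⟨g, hg⟩ := hU.exists_isometryEquiv_apply_eq p q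
  have h2 := hC (φ g)
  simp only [l, ContinuousMulEquiv.symm_apply_apply, hg, hq] at h2
  linarith [le_abs_self C]
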